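/- Let $m$ be a positive integer. For a positive integer $n$, order $\mathbb{Z}_{\ge 0}^m\times\{0,\dots,n-1\}$ by $(\tau,i)\le(\eta,j)$ iff $i=j$ and $\tau_t\le\eta_t$ for all $t=1,\dots,m$, and put $\deg(\tau,i)=\tau_1+\dots+\tau_m$. A finite sequence $a_1,\dots,a_k$ is called an antichain sequence if $a_i\not\le a_j$ for all $i\ne j$. For $f\colon\mathbb{Z}_{\ge 0}\to\mathbb{Z}_{\ge 0}$ let $\mathfrak{L}_{f,m}^n$ be the maximal length $k$ of an antichain sequence $a_1,\dots,a_k$ in $\mathbb{Z}_{\ge 0}^m\times\{0,\dots,n-1\}$ with $\deg a_i\le f(i)$ for $i=1,\dots,k$. For strictly increasing $f$ and rational $x$, let $\lceil f^{-1}(x)\rceil$ be the least $k\in\mathbb{Z}_{\ge 0}$ with $f(k)\ge x$. Let $A$ be the Ackermann function: $A(0,y)=y+1$, $A(x+1,0)=A(x,1)$, $A(x+1,y+1)=A(x,A(x+1,y))$ for $x,y\ge 0$. Let $f\colon\mathbb{Z}_{\ge 0}\to\mathbb{Z}_{\ge 0}$ be strictly increasing with $f(i+1)\ge 2f(i)$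 for all $i>0$, and let $d\in\mathbb{Z}_{\ge 0}$ satisfy $2f(i+1)\le A(d,f(i)-1)$ for all $i>0$. Then $\mathfrak{L}_{f,m}^1$ exists (is finite) and $$\mathfrak{L}_{f,m}^1<\big\lceil f^{-1}\big(A(m+d,\,2f(1)-1)\big)\big\rceil.$$ If moreover $d\ge 3$, then for every integer $n>1$ the number $\mathfrak{L}_{f,m}^n$ exists (is finite) and $$\mathfrak{L}_{f,m}^n<\big\lceil f^{-1}\big(A(m+d+2,\,2nf(1)-1)/n\big)\big\rceil.$$ -/

import Mathlib

namespace AntichainBound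

/-- Elements `(τ, i)` of `ℤ_{≥0}^m × n`, where `n = {0, …, n - 1}`. -/
abbrev Pt (m n : ℕ) : Type := (Fin m → ℕ) × Fin n

/-- The order on `ℤ_{≥0}^m × n`: `(τ, i) ≤ (η, j)` iff `i = j` and `τ ≤ η` in the product order.
(This is not the product order on `Pt m n`, since `Fin n` is taken with equality.) -/
def Pt.Below {m n : ℕ} (a b : Pt m n) : Prop := a.2 = b.2 ∧ ∀ t, a.1 t ≤ b.1 t

/-- The degree of `(τ, i)` is `τ_1 + ⋯ + τ_m`. -/
def Pt.deg {m n : ℕ} (a : Pt m n) : ℕ := ∑ t, a.1 t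

/-- A finite sequence is an antichain sequence if no term lies below another one. -/
def IsAntichainSeq {m n k : ℕ} (a : Fin k → Pt m n) : Prop :=
  ∀ i j, i ≠ j → ¬ Pt.Below (a i) (a j)

/-- The degree growth of `a_1, …, a_k` is bounded by `f`: `deg a_i ≤ f i` for `1 ≤ i ≤ k`.
The sequence is indexed by `Fin k`, so the term of index `i : Fin k` is `a_{i+1}`. -/
def DegGrowthBounded {m n k : ℕ} (f : ℕ → ℕ) (a : Fin k → Pt m n) : Prop :=
  ∀ i : Fin k, Pt.deg (a i) ≤ f ((i : ℕ) + 1)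

/-- The lengths of antichain sequences of `ℤ_{≥0}^m × n` with degree growth bounded by `f`. -/
def antichainLengths (f : ℕ → ℕ) (m n : ℕ) : Set ℕ :=
  {k | ∃ a : Fin k → Pt m n, IsAntichainSeq a ∧ DegGrowthBounded f a}

/-- `𝔏_{f,m}^n`, the maximal length of an antichain sequence of `ℤ_{≥0}^m × n` with degree growth
bounded by `f`. -/
noncomputable def maxAntichainLength (f : ℕ → ℕ) (m n : ℕ) : ℕ := sSup (antichainLengths f m n)

/-- `⌈f⁻¹(x)⌉`, the least natural number `k` with `f k ≥ x` (it exists if `f` is strictly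
increasing). -/
noncomputable def ceilInv (f : ℕ → ℕ) (x : ℚ) : ℕ := sInf {k : ℕ | x ≤ (f k : ℚ)}

end AntichainBound

namespace AntichainBound

/-! ### Growth of the Ackermann function. -/

section Ackermann

/-! The terms not yet read are kept inside finitely many boxes. Reading a term `x` in a box leaves
only points incomparable to `x`; each has some free coordinate smaller than that of `x`, so at most
`deg x` slices of one dimension less replace the box (`Box.exists_slices`). As the degree bound `H`
doubles, the number of boxes stays at most `H`. By induction on `D`, using up the boxes of dimension
at most `D` raises `H` by at most `ack (d + D)` (`Covers.exists_phase`): each box of dimension `D +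
1` costs two more applications of the previous level, and there are at most `H i` of them, so the
iteration is absorbed by the next level. The theorem takes `H i = f (i + 1)` for one copy and `n * f
(i + 1)` for `n` copies. -/

theorem two_mul_ack_le_ack_succ {d : ℕ} (hd : 3 ≤ d) (y : ℕ) : 2 * ack d y ≤ ack d (y + 1) := by
  obtain ⟨e, rfl⟩ : ∃ e, d = e + 1 := ⟨d - 1, by omega⟩
  rw [ack_succ_succ]
  have h := ack_mono_left (ack (e + 1) y) (show 2 ≤ e by omega)
  simp only [ack_two] at h
  omega

theorem four_mul_add_five_le_ack {d : ℕ} (hd : 3 ≤ d) (y : ℕ) : 4 * y + 5 ≤ ack d y := by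
  refine le_trans ?_ (show ack 3 y ≤ ack d y from ack_mono_left y hd)
  clear hd
  induction y with
  | zero => simp
  | succ y ih => have := two_mul_ack_le_ack_succ le_rfl y; omega

/-- This turns iteration of one level into a shift of the argument at the next. -/
theorem iterate_ack_ack_succ (e r y : ℕ) : (ack e)^[r] (ack (e + 1) y) = ack (e + 1) (y + r) := by
  induction r with
  | zero => rfl
  | succ r ih => rw [Function.iterate_succ_apply', ih, ← add_assoc, ack_succ_succ]

/-- Each unit step of the argument doubles the value, which outpaces the factor `n`. Hence `n * f`
inherits the growth hypothesis of `f`. -/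
theorem mul_ack_le_ack_mul {d : ℕ} (hd : 3 ≤ d) {n y : ℕ} (hn : 0 < n) (hy : 0 < y) :
    n * ack d (y - 1) ≤ ack d (n * y - 1) := by
  have key : ∀ r z, (r + 1) * ack d z ≤ ack d (z + r) := by
    intro r z
    induction r with
    | zero => simp
    | succ r ih =>
      have h1 := two_mul_ack_le_ack_succ hd (z + r)
      have h2 : (r + 1 + 1) * ack d z ≤ 2 * ((r + 1) * ack d z) := by nlinarith
      exact h2.trans ((Nat.mul_le_mul_left 2 ih).trans h1)
  obtain ⟨r, rfl⟩ : ∃ r, n = r + 1 := ⟨n - 1, by omega⟩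
  refine (key r (y - 1)).trans (ack_mono_right d ?_)
  have : r * 1 ≤ r * y := Nat.mul_le_mul_left r hy
  rw [add_mul]
  omega

end Ackermann

/-! ### Covers by boxes. -/

/-- An axis-parallel box: the points of one copy of `ℕ^m` with some coordinates prescribed. -/
abbrev Box (m n : ℕ) : Type := (Fin m → Option ℕ) × Fin n

/-- The point `x` lies in the box `b`. -/
def Box.Mem {m n : ℕ} (b : Box m n) (x : Pt m n) : Prop :=
  x.2 = b.2 ∧ ∀ t c, b.1 t = some c → x.1 t = c

/-- The number of coordinates that the box leaves free. -/
def Box.dim {m n : ℕ} (b : Box m n) : ℕ := (Finset.univ.filter fun t => b.1 t = none).card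

theorem Box.dim_update {m n : ℕ} (b : Box m n) {t : Fin m} (ht : b.1 t = none) (c : ℕ) :
    Box.dim ((Function.update b.1 t (some c), b.2) : Box m n) = b.dim - 1 := by
  unfold Box.dim
  rw [← Finset.card_erase_of_mem (a := t) (by simp [ht])]
  congr 1
  ext u
  by_cases hu : u = t <;> simp [hu, Function.update_apply]

/-- The points of a box that are incomparable to a point `x` of it are covered by at most `deg x`
boxes of smaller positive dimension. -/
theorem Box.exists_slices {m n : ℕ} (b : Box m n) (x : Pt m n) (hx : b.Mem x) :
    ∃ u : Finset (Box m n), u.card ≤ x.deg ∧ (∀ c ∈ u, c.dim = b.dim - 1 ∧ 0 < c.dim) ∧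
      ∀ y, b.Mem y → ¬ x.Below y → ¬ y.Below x → ∃ c ∈ u, c.Mem y := by
  classical
  refine ⟨(((Finset.univ.filter fun t => b.1 t = none).biUnion fun t =>
    (Finset.range (x.1 t)).image fun c =>
      ((Function.update b.1 t (some c), b.2) : Box m n))).filter fun c => 0 < c.dim, ?_, ?_, ?_⟩
  · refine (Finset.card_filter_le _ _).trans (Finset.card_biUnion_le.trans ?_)
    refine le_trans (Finset.sum_le_sum fun t _ => Finset.card_image_le) ?_
    simp only [Finset.card_range]
    exact Finset.sum_le_sum_of_subset (Finset.filter_subset _ _)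
  · intro c hc
    simp only [Finset.mem_filter, Finset.mem_biUnion, Finset.mem_univ, true_and,
      Finset.mem_image] at hc
    obtain ⟨⟨t, ht, v, -, rfl⟩, hpos⟩ := hc
    exact ⟨b.dim_update ht v, hpos⟩
  · intro y hy hxy hyx
    have hcopy : x.2 = y.2 := hx.1.trans hy.1.symm
    obtain ⟨t, ht⟩ : ∃ t, y.1 t < x.1 t := by
      by_contra! h
      exact hxy ⟨hcopy, h⟩
    have hfree : b.1 t = none := by
      cases hb : b.1 t with
      | none => rfl
      | some c => have := hx.2 t c hb; have := hy.2 t c hb; omega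
    refine ⟨(Function.update b.1 t (some (y.1 t)), b.2), ?_, hy.1, ?_⟩
    · simp only [Finset.mem_filter, Finset.mem_biUnion, Finset.mem_univ, true_and,
        Finset.mem_image]
      -- If `t` were the only free coordinate, `y` would differ from `x` only at `t`, where it is
      -- smaller, so `y` would lie below `x`.
      refine ⟨⟨t, hfree, y.1 t, Finset.mem_range.2 ht, rfl⟩, Nat.pos_of_ne_zero fun h0 => ?_⟩
      refine hyx ⟨hcopy.symm, fun u => ?_⟩
      by_cases hu : u = t
      · subst hu; exact ht.le
      · cases hb : b.1 u with
        | some c => rw [hx.2 u c hb, hy.2 u c hb]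
        | none =>
          rw [Box.dim, Finset.card_eq_zero] at h0
          have : u ∈ (∅ : Finset (Fin m)) := by
            rw [← h0]; simp [Function.update_apply, hu, hb]
          simp at this
    · intro u c hc
      by_cases hu : u = t
      · subst hu; simpa using hc
      · exact hy.2 u c (by simpa [Function.update_apply, hu] using hc)

/-- The terms of `a` of index at least `i` lie in the boxes of `s`, which have positive
dimension. -/
def Covers {m n k : ℕ} (a : Fin k → Pt m n) (i : ℕ) (s : Finset (Box m n)) : Prop :=
  (∀ b ∈ s, 0 < b.dim) ∧ ∀ j : Fin k, i ≤ j → ∃ b ∈ s, b.Mem (a j)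

/-- Removing the term `a i` from an antichain sequence replaces a box that contains it by
slices. -/
theorem Covers.exists_succ {m n k : ℕ} {a : Fin k → Pt m n} (ha : IsAntichainSeq a)
    {i : Fin k} {s : Finset (Box m n)} (hs : Covers a i s) {b : Box m n} (hb : b ∈ s)
    (hbi : b.Mem (a i)) :
    ∃ s' : Finset (Box m n), Covers a (i + 1) s' ∧ s'.card + 1 ≤ s.card + (a i).deg ∧
      ∀ c ∈ s', (c ∈ s ∧ c ≠ b) ∨ c.dim < b.dim := by
  classical
  obtain ⟨u, hucard, hudim, hucov⟩ := b.exists_slices (a i) hbi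
  refine ⟨s.erase b ∪ u, ⟨?_, ?_⟩, ?_, ?_⟩
  · intro c hc
    rcases Finset.mem_union.1 hc with hc | hc
    · exact hs.1 c (Finset.mem_of_mem_erase hc)
    · exact (hudim c hc).2
  · intro j hj
    obtain ⟨c, hc, hcj⟩ := hs.2 j (by omega)
    by_cases hcb : c = b
    · subst hcb
      have hij : i ≠ j := by rintro rfl; omega
      obtain ⟨e, he, hej⟩ := hucov (a j) hcj (ha i j hij) (ha j i hij.symm)
      exact ⟨e, Finset.mem_union_right _ he, hej⟩
    · exact ⟨c, Finset.mem_union_left _ (Finset.mem_erase.2 ⟨hcb, hc⟩), hcj⟩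
  · have h1 := Finset.card_union_le (s.erase b) u
    have h2 := Finset.card_erase_add_one hb
    omega
  · intro c hc
    rcases Finset.mem_union.1 hc with hc | hc
    · exact .inl ⟨Finset.mem_of_mem_erase hc, Finset.ne_of_mem_erase hc⟩
    · have := hudim c hc
      exact .inr (by omega)

/-! ### Growth of the degree bound, by dimension. -/

/-- While the terms come from boxes of dimension at most `D`, the degree bound `H` grows at most
like the Ackermann function of level `d + D`. -/
theorem Covers.exists_phase {m n k : ℕ} {a : Fin k → Pt m n} (ha : IsAntichainSeq a)
    {H : ℕ → ℕ} {d : ℕ} (hd3 : 3 ≤ d) (hpos : ∀ i, 0 < H i) (hdouble : ∀ i, 2 * H i ≤ H (i + 1))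
    (hack : ∀ i, 2 * H (i + 1) ≤ ack d (H i - 1)) (hdeg : ∀ i : Fin k, (a i).deg ≤ H i) (D : ℕ) :
    ∀ (i : ℕ) (s : Finset (Box m n)), i ≤ k → Covers a i s → s.card ≤ H i →
      ∃ (i' : ℕ) (s' : Finset (Box m n)), i' ≤ k ∧ Covers a i' s' ∧ s'.card ≤ H i' ∧
        (∀ c ∈ s', D < c.dim → c ∈ s) ∧ H i' ≤ ack (d + D) (4 * H i) ∧
        ∀ hi : i' < k, ∃ b ∈ s', D < b.dim ∧ b.Mem (a ⟨i', hi⟩) := by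
  induction D with
  | zero =>
    intro i s hik hs hcard
    refine ⟨i, s, hik, hs, hcard, fun c hc _ => hc, ?_, fun hi => ?_⟩
    · have := four_mul_add_five_le_ack (d := d + 0) hd3 (4 * H i); omega
    · obtain ⟨b, hb, hbi⟩ := hs.2 ⟨i, hi⟩ le_rfl
      exact ⟨b, hb, hs.1 b hb, hbi⟩
  | succ D ih =>
    have hid : ∀ z, z ≤ ack (d + D) z := fun z => (lt_ack_right _ z).le
    have hmono : ∀ r, Monotone (ack (d + D))^[r] := (ack_mono_right (d + D)).iterate
    -- Here `r` bounds the number of boxes of dimension `D + 1` still to be opened.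
    have inner : ∀ (r i : ℕ) (s : Finset (Box m n)), i ≤ k → Covers a i s → s.card ≤ H i →
        (s.filter fun c => c.dim = D + 1).card ≤ r →
        ∃ (i' : ℕ) (s' : Finset (Box m n)), i' ≤ k ∧ Covers a i' s' ∧ s'.card ≤ H i' ∧
          (∀ c ∈ s', D + 1 < c.dim → c ∈ s) ∧
          H i' ≤ (ack (d + D))^[2 * r + 1] (4 * H i) ∧
          ∀ hi : i' < k, ∃ b ∈ s', D + 1 < b.dim ∧ b.Mem (a ⟨i', hi⟩) := by
      intro r
      induction r with
      | zero =>
        intro i s hik hs hcard hr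
        obtain ⟨i', s', hik', hs', hcard', hsub, hH, hend_box⟩ := ih i s hik hs hcard
        refine ⟨i', s', hik', hs', hcard', fun c hc h => hsub c hc (by omega), hH, fun hi => ?_⟩
        obtain ⟨b, hb, hbD, hbi⟩ := hend_box hi
        refine ⟨b, hb, ?_, hbi⟩
        by_contra hlt
        have hbs : b ∈ s.filter fun c => c.dim = D + 1 :=
          Finset.mem_filter.2 ⟨hsub b hb hbD, by omega⟩
        have := Finset.card_pos.2 ⟨b, hbs⟩
        omega
      | succ r ihr =>
        intro i s hik hs hcard hr
        obtain ⟨i', s', hik', hs', hcard', hsub, hH, hend_box⟩ := ih i s hik hs hcard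
        by_cases hdone : ∀ hi : i' < k, ∃ b ∈ s', D + 1 < b.dim ∧ b.Mem (a ⟨i', hi⟩)
        · refine ⟨i', s', hik', hs', hcard', fun c hc h => hsub c hc (by omega), ?_, hdone⟩
          rw [Function.iterate_succ_apply']
          exact hH.trans (ack_mono_right _ (Function.id_le_iterate_of_id_le hid _ _))
        · push Not at hdone
          obtain ⟨hi, hno⟩ := hdone
          obtain ⟨b, hb, hbD, hbi⟩ := hend_box hi
          have hbdim : b.dim = D + 1 := by
            by_contra hne
            exact hno b hb (by omega) hbi
          obtain ⟨s₂, hs₂, hcard₂, hsub₂⟩ := hs'.exists_succ ha (i := ⟨i', hi⟩) hb hbi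
          have hsub₂' : ∀ c ∈ s₂, D < c.dim → c ∈ s ∧ c ≠ b := by
            intro c hc hcD
            rcases hsub₂ c hc with h | h
            · exact ⟨hsub c h.1 hcD, h.2⟩
            · omega
          have hcard₃ : s₂.card ≤ H (i' + 1) := by
            have := hdouble i'
            have := hdeg ⟨i', hi⟩
            simp only at this
            omega
          have hr₂ : (s₂.filter fun c => c.dim = D + 1).card ≤ r := by
            have hbs : b ∈ s.filter fun c => c.dim = D + 1 :=
              Finset.mem_filter.2 ⟨hsub b hb hbD, hbdim⟩
            have hss : (s₂.filter fun c => c.dim = D + 1) ⊂ s.filter fun c => c.dim = D + 1 := by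
              refine (Finset.ssubset_iff_of_subset ?_).2 ⟨b, hbs, ?_⟩
              · intro c hc
                obtain ⟨hc, hcd⟩ := Finset.mem_filter.1 hc
                exact Finset.mem_filter.2 ⟨(hsub₂' c hc (by omega)).1, hcd⟩
              · intro hc
                obtain ⟨hc, hcd⟩ := Finset.mem_filter.1 hc
                exact (hsub₂' b hc (by omega)).2 rfl
            have := Finset.card_lt_card hss
            omega
          obtain ⟨i'', s₃, hik₃, hs₃, hcard₃, hsub₃, hH₃, hend_box₃⟩ :=
            ihr (i' + 1) s₂ hi hs₂ hcard₃ hr₂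
          refine ⟨i'', s₃, hik₃, hs₃, hcard₃, fun c hc h => (hsub₂' c (hsub₃ c hc h) (by omega)).1,
            hH₃.trans ?_, hend_box₃⟩
          have hstep : 4 * H (i' + 1) ≤ (ack (d + D))^[2] (4 * H i) := by
            have h1 := hack i'
            have h2 := two_mul_ack_le_ack_succ hd3 (H i' - 1)
            rw [Nat.sub_add_cancel (hpos i')] at h2
            have h3 : ack d (H i') ≤ ack (d + D) (ack (d + D) (4 * H i)) :=
              ack_le_ack (Nat.le_add_right d D) hH
            change _ ≤ ack (d + D) (ack (d + D) (4 * H i))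
            omega
          have := hmono (2 * r + 1) hstep
          rwa [← Function.iterate_add_apply] at this
    intro i s hik hs hcard
    obtain ⟨i', s', hik', hs', hcard', hsub, hH, hend_box⟩ :=
      inner (H i) i s hik hs hcard ((Finset.card_filter_le _ _).trans hcard)
    refine ⟨i', s', hik', hs', hcard', hsub, hH.trans ?_, hend_box⟩
    -- The argument becomes `H i + (2 * H i + 1)`, at most `4 * H i` because `H i` is positive.
    have h4 : 4 * H i ≤ ack (d + D + 1) (H i) := by
      have := four_mul_add_five_le_ack (d := d + D + 1) (by omega) (H i); omega
    refine (hmono _ h4).trans ?_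
    rw [iterate_ack_ack_succ]
    have := hpos i
    exact ack_mono_right _ (by omega)

/-- The degree bound at the end of an antichain sequence whose terms from `i` on are covered by
boxes of dimension at most `D`. -/
theorem Covers.length_bound {m n k : ℕ} {a : Fin k → Pt m n} (ha : IsAntichainSeq a)
    {H : ℕ → ℕ} {d : ℕ} (hd3 : 3 ≤ d) (hpos : ∀ i, 0 < H i) (hdouble : ∀ i, 2 * H i ≤ H (i + 1))
    (hack : ∀ i, 2 * H (i + 1) ≤ ack d (H i - 1)) (hdeg : ∀ i : Fin k, (a i).deg ≤ H i)
    {D i : ℕ} {s : Finset (Box m n)} (hik : i ≤ k) (hs : Covers a i s) (hcard : s.card ≤ H i)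
    (hD : ∀ b ∈ s, b.dim ≤ D) : H k ≤ ack (d + D) (4 * H i) := by
  obtain ⟨i', s', hik', hs', -, hsub, hH, hend_box⟩ :=
    exists_phase ha hd3 hpos hdouble hack hdeg D i s hik hs hcard
  rcases hik'.eq_or_lt with rfl | hi
  · exact hH
  · obtain ⟨b, hb, hbD, -⟩ := hend_box hi
    have := hD b (hsub b hb hbD)
    omega

/-- The whole space is covered by `n` boxes of dimension `m`. -/
theorem exists_covers_zero {m n k : ℕ} (hm : 0 < m) (a : Fin k → Pt m n) :
    ∃ s : Finset (Box m n), Covers a 0 s ∧ s.card ≤ n ∧ ∀ b ∈ s, b.dim = m := by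
  classical
  have hdim : ∀ b : Box m n, b ∈ (Finset.univ.image fun j : Fin n =>
      ((fun _ => none, j) : Box m n)) →
      b.dim = m := by
    intro b hb
    obtain ⟨j, -, rfl⟩ := Finset.mem_image.1 hb
    simp [Box.dim]
  refine ⟨Finset.univ.image fun j : Fin n => ((fun _ => none, j) : Box m n), ⟨?_, ?_⟩, ?_, hdim⟩
  · intro b hb
    rw [hdim b hb]; exact hm
  · intro j _
    exact ⟨(fun _ => none, (a j).2), Finset.mem_image_of_mem _ (Finset.mem_univ _), rfl, by simp⟩
  · exact Finset.card_image_le.trans (by simp)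

/-! ### The final bounds. -/

theorem isGreatest_and_lt_ceilInv {f : ℕ → ℕ} (hf : StrictMono f) {m n : ℕ} {x : ℚ}
    (h : ∀ k ∈ antichainLengths f m n, (f k : ℚ) < x) :
    IsGreatest (antichainLengths f m n) (maxAntichainLength f m n) ∧
      maxAntichainLength f m n < ceilInv f x := by
  have hne : {k : ℕ | x ≤ (f k : ℚ)}.Nonempty := by
    refine ⟨⌈x⌉₊, (Nat.le_ceil x).trans ?_⟩
    exact_mod_cast hf.le_apply
  have hlt : ∀ k ∈ antichainLengths f m n, k < ceilInv f x := by
    intro k hk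
    by_contra! hle
    have h1 : x ≤ (f (ceilInv f x) : ℚ) := Nat.sInf_mem hne
    have h2 : (f (ceilInv f x) : ℚ) ≤ f k := by exact_mod_cast hf.monotone hle
    exact absurd (h k hk) (not_lt.2 (h1.trans h2))
  have hbdd : BddAbove (antichainLengths f m n) := ⟨_, fun k hk => (hlt k hk).le⟩
  have hzero : 0 ∈ antichainLengths f m n :=
    ⟨fun i => i.elim0, fun i => i.elim0, fun i => i.elim0⟩
  have hmem : maxAntichainLength f m n ∈ antichainLengths f m n := Nat.sSup_mem ⟨0, hzero⟩ hbdd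
  exact ⟨⟨hmem, fun k hk => le_csSup hbdd hk⟩, hlt _ hmem⟩

/-- Since `ack 2 y = 2 * y + 3`, level `2` would give `2 * f 2 ≤ 2 * f 1 + 1`, against `f 1 < f 2`.
-/
theorem three_le_of_growth {f : ℕ → ℕ} (hf : StrictMono f) {d : ℕ}
    (hd : ∀ i : ℕ, 0 < i → 2 * f (i + 1) ≤ ack d (f i - 1)) : 3 ≤ d := by
  by_contra! hlt
  have h1 := hd 1 one_pos
  have h2 := ack_mono_left (f 1 - 1) (show d ≤ 2 by omega)
  simp only [ack_two] at h2
  have h3 := hf (show 1 < 1 + 1 by omega)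
  have h4 := hf (show 0 < 1 by omega)
  omega

theorem lt_ack_of_mem_antichainLengths_one {f : ℕ → ℕ} (hf : StrictMono f)
    (hf2 : ∀ i : ℕ, 0 < i → 2 * f i ≤ f (i + 1))
    {d : ℕ} (hd : ∀ i : ℕ, 0 < i → 2 * f (i + 1) ≤ ack d (f i - 1))
    {m : ℕ} (hm : 0 < m) {k : ℕ} (hk : k ∈ antichainLengths f m 1) :
    f k < ack (m + d) (2 * f 1 - 1) := by
  have hd3 := three_le_of_growth hf hd
  have hfpos : 0 < f 1 := (Nat.zero_le _).trans_lt (hf one_pos)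
  obtain ⟨a, ha, hdeg⟩ := hk
  rcases k.eq_zero_or_pos with rfl | hkpos
  · have h1 := hf (show 0 < 1 by omega)
    have h2 := lt_ack_right (m + d) (2 * f 1 - 1)
    omega
  -- Reading the first term by hand leaves only boxes of dimension `m - 1`, which saves a level over
  -- the case of several copies.
  obtain ⟨s, hs, hscard, hsdim⟩ := exists_covers_zero hm a
  obtain ⟨b, hb, hb0⟩ := hs.2 ⟨0, hkpos⟩ le_rfl
  obtain ⟨s', hs', hcard', hsub⟩ := hs.exists_succ ha (i := ⟨0, hkpos⟩) hb hb0
  have hdeg0 := hdeg ⟨0, hkpos⟩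
  simp only [zero_add] at hdeg0 hs'
  have hf12 := hf (show 1 < 2 by omega)
  have hH := hs'.length_bound (H := fun i => f (i + 1)) (d := d) (D := m - 1) ha hd3
    (fun i => (Nat.zero_le _).trans_lt (hf i.succ_pos)) (fun i => hf2 (i + 1) i.succ_pos)
    (fun i => hd (i + 1) i.succ_pos) hdeg hkpos
    (by change s'.card ≤ f 2; omega) (by
      intro c hc
      have hbdim := hsdim b hb
      rcases hsub c hc with ⟨hcs, hcb⟩ | h
      · exact absurd (Finset.card_le_one.1 hscard c hcs b hb) hcb
      · omega)
  refine (hf k.lt_succ_self).trans_le (hH.trans ?_)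
  change ack (d + (m - 1)) (4 * f 2) ≤ _
  obtain ⟨l, rfl⟩ : ∃ l, m = l + 1 := ⟨m - 1, by omega⟩
  obtain ⟨y, hy⟩ : ∃ y, f 1 = y + 1 := ⟨f 1 - 1, by omega⟩
  have h1 := hd 1 one_pos
  rw [hy, Nat.add_sub_cancel] at h1
  have h2 := two_mul_ack_le_ack_succ hd3 y
  have h3 : ack d (y + 1) ≤ ack (d + l) (2 * y + 1) := ack_le_ack (by omega) (by omega)
  have h4 := ack_succ_right_le_ack_succ_left (d + l) (2 * y)
  rw [show l + 1 + d = d + l + 1 by ring, show 2 * f 1 - 1 = 2 * y + 1 by omega, ack_succ_succ,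
    Nat.add_sub_cancel]
  refine ack_mono_right _ ?_
  change 2 * f 2 ≤ _ at h1
  omega

theorem mul_lt_ack_of_mem_antichainLengths {f : ℕ → ℕ} (hf : StrictMono f)
    (hf2 : ∀ i : ℕ, 0 < i → 2 * f i ≤ f (i + 1))
    {d : ℕ} (hd : ∀ i : ℕ, 0 < i → 2 * f (i + 1) ≤ ack d (f i - 1))
    {m : ℕ} (hm : 0 < m) {n : ℕ} (hn : 0 < n) {k : ℕ} (hk : k ∈ antichainLengths f m n) :
    n * f k < ack (m + d + 2) (2 * n * f 1 - 1) := by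
  have hd3 := three_le_of_growth hf hd
  have hfpos : ∀ i, 0 < f (i + 1) := fun i => (Nat.zero_le _).trans_lt (hf i.succ_pos)
  obtain ⟨a, ha, hdeg⟩ := hk
  obtain ⟨s, hs, hscard, hsdim⟩ := exists_covers_zero hm a
  have hH := hs.length_bound (H := fun i => n * f (i + 1)) (d := d) (D := m) ha hd3
    (fun i => Nat.mul_pos hn (hfpos i))
    (fun i => by have := Nat.mul_le_mul_left n (hf2 (i + 1) i.succ_pos); linarith)
    (fun i => by
      have := Nat.mul_le_mul_left n (hd (i + 1) i.succ_pos)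
      have := mul_ack_le_ack_mul hd3 hn (hfpos i)
      linarith)
    (fun i => (hdeg i).trans (Nat.le_mul_of_pos_left _ hn)) k.zero_le
    (hscard.trans (Nat.le_mul_of_pos_right _ (hfpos 0)))
    (fun b hb => (hsdim b hb).le)
  refine (Nat.mul_lt_mul_of_pos_left (hf k.lt_succ_self) hn).trans_le (hH.trans ?_)
  have hpos := Nat.mul_pos hn (hfpos 0)
  rw [zero_add] at hpos
  obtain ⟨y, hy⟩ : ∃ y, n * f 1 = y + 1 := ⟨n * f 1 - 1, by omega⟩
  have h1 := four_mul_add_five_le_ack (d := m + d + 1 + 1) (by omega) (2 * y)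
  rw [show 2 * n * f 1 - 1 = 2 * y + 1 by rw [mul_assoc]; omega, ack_succ_succ]
  refine ack_le_ack (by omega) ?_
  change 4 * (n * f 1) ≤ _
  omega

end AntichainBound

/-- Here `ack` is the Ackermann function. As `f` is strictly increasing, `f i ≥ 1` for `i ≥ 1`, so
that no subtraction below is truncated. The `IsGreatest` clauses say that the maximal lengths
exist. -/
theorem mainTheorem4 (f : ℕ → ℕ) (hf : StrictMono f)
    (hf2 : ∀ i : ℕ, 0 < i → 2 * f i ≤ f (i + 1))
    (d : ℕ) (hd : ∀ i : ℕ, 0 < i → 2 * f (i + 1) ≤ ack d (f i - 1))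
    (m : ℕ) (hm : 0 < m) :
    (IsGreatest (AntichainBound.antichainLengths f m 1)
        (AntichainBound.maxAntichainLength f m 1) ∧
      AntichainBound.maxAntichainLength f m 1 <
        AntichainBound.ceilInv f (ack (m + d) (2 * f 1 - 1) : ℚ)) ∧
    (3 ≤ d → ∀ n : ℕ, 1 < n →
      IsGreatest (AntichainBound.antichainLengths f m n)
        (AntichainBound.maxAntichainLength f m n) ∧
      AntichainBound.maxAntichainLength f m n <
        AntichainBound.ceilInv f
          ((ack (m + d + 2) (2 * n * f 1 - 1) : ℚ) / (n : ℚ))) := by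
  refine ⟨AntichainBound.isGreatest_and_lt_ceilInv hf fun k hk => ?_, fun _ n hn =>
    AntichainBound.isGreatest_and_lt_ceilInv hf fun k hk => ?_⟩
  · exact_mod_cast AntichainBound.lt_ack_of_mem_antichainLengths_one hf hf2 hd hm hk
  · have hn0 : 0 < n := by omega
    rw [lt_div_iff₀ (by exact_mod_cast hn0), mul_comm]
    exact_mod_cast AntichainBound.mul_lt_ack_of_mem_antichainLengths hf hf2 hd hm hn0 hk
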